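/- **Setting.** Let $m\ge 3$. Node $j\in\{1,\dots,m\}$ observes $\mathbf X_j=(X_j(1),\dots,X_j(n))$, where all $X_j(s)$ are independent $\mathrm{Ber}(1/2)$ bits. Node $1$ must compute the samplewise minimum $Z(s)=\min_{1\le j\le m}X_j(s)$, $s=1,\dots,n$; the other nodes compute nothing. The available directed links are $\mathcal E=\{(j,1),(1,j):2\le j\le m\}$ (star with centre $1$). A *$t$-round interactive code* of blocklength $n$ has, for each round $i\le t$ and each link $(j,k)\in\mathcal E$, a message $M_{jki}$ from $j$ to $k$ with values in a finite non-empty alphabet $\mathcal M_{jki}$, which is a deterministic function of $\mathbf X_j$ and of all messages to and from $j$ in rounds $1,\dots,i-1$; the messages of one round are sent concurrently. After round $t$, node $1$ forms an estimate $\widehat{\mathbf Z}$ from $\mathbf X_1$ and all messages to and from it. A *protocol* is a sequence $\mathcal E_1,\dots,\mathcal E_t\subseteq\mathcal E$; a code follows it if $|\mathcal M_{jki}|=1$ (null message) whenever $(j,k)\notin\mathcal E_i$. A rate tuple $(R_{jki})_{(j,k)\in\mathcal E,\,i\le t}$ is *admissible* under the protocol if for every $\epsilon>0$ there is $N$ such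 that for all $n>N$ some code of blocklength $n$ following the protocol satisfies $\frac1n\log_2|\mathcal M_{jki}|\le R_{jki}+\epsilon$ for all $(j,k)\in\mathcal E$, $i\le t$, and $\mathbb P(\widehat{\mathbf Z}\ne\mathbf Z)\le\epsilon$. Its *sum-total-rate* is $\sum_{i\le t}\sum_{(j,k)\in\mathcal E}R_{jki}$. Let $R_{sum,t}=R_{sum,t}(m)$ be the minimum (infimum) of the sum-total-rate over all tuples admissible under the unrestricted protocol $\mathcal E_i=\mathcal E$, $i\le t$; let $t^*$ be the least $t$ for which an admissible tuple exists. Write $h_2(p)=-p\log_2p-(1-p)\log_2(1-p)$. **Claim.** 1. For every $m\ge3$, $t^*=1$ and $R_{sum,1}=m-1$. Moreover, for every $t\ge1$, the minimum sum-total-rate over the tuples admissible under the non-interactive protocol $\mathcal E_i=\{(j,1):2\le j\le m\}$, $i\le t$, is exactly $m-1$. 2. For every $m\ge3$, consider the $(2m-2)$-round protocol in which, for $i=1,\dots,m-1$, only the link $(1,i+1)$ may be active in round $2i-1$ and only the link $(i+1,1)$ may be active in round $2i$. Under this protocol the rates $R_{1(i+1)(2i-1)}=h_2(2^{-i})$,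 $R_{(i+1)1(2i)}=2^{-i}$ ($1\le i\le m-1$), all other rates $0$, are admissible. Their sum-total-rate is $$\sum_{i=1}^{m-1}\left(h_2(2^{-i})+2^{-i}\right)<3+\log_2e ,$$ and hence $R_{sum,2m-2}<3+\log_2 e$. 3. For every $m\ge6$, $R_{sum,2m-2}<R_{sum,t^*}=R_{sum,1}$. As $m\to\infty$, $R_{sum,1}(m)=\Theta(m)$ whereas $R_{sum,2m-2}(m)=O(1)$. -/

import Mathlib

open MeasureTheory Asymptotics Filter

/-- A function computation problem over a network with node set `V`: the sources take values in
the alphabet `α`, the computed functions take values in `β`. -/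
structure NetworkProblem (V α β : Type) [MeasurableSpace α] where
  /-- joint law of one sample `(X_v)_{v ∈ V}` of the sources -/
  source : Measure (V → α)
  isProbabilityMeasure_source : IsProbabilityMeasure source
  /-- `target j` is the samplewise function that node `j` has to compute -/
  target : V → (V → α) → β
  /-- the directed links `(j, k)` (from `j` to `k`) available for communication -/
  links : Finset (V × V)

/-- A `t`-round interactive block code of blocklength `n` with concurrent messages. In round `i`
the message from `j` to `k` lies in an alphabet with `size i j k` elements; a null message is a
message whose alphabet has one element. It is a function of the source block at `j` and
of all messages from and to `j` in the earlier rounds. After the last round node `j` produces its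
estimate from its source block and all messages from and to `j`. -/
structure NetworkCode (V α β : Type) (t n : ℕ) where
  size : Fin t → V → V → ℕ
  size_pos : ∀ i j k, 0 < size i j k
  enc : ∀ (i : Fin t) (j k : V), (Fin n → α) →
    (∀ i' : Fin t, i' < i → ∀ k' : V, Fin (size i' j k') × Fin (size i' k' j)) →
    Fin (size i j k)
  dec : ∀ j : V, (Fin n → α) →
    (∀ (i' : Fin t) (k' : V), Fin (size i' j k') × Fin (size i' k' j)) → (Fin n → β)

namespace NetworkCode

variable {V α β : Type} {t n : ℕ}

/-- The message sent from `j` to `k` in round `i` when the source block is `x`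
(`x s v` is the sample of source `v` at time `s`). -/
def msg (c : NetworkCode V α β t n) (x : Fin n → V → α) (i : Fin t) (j k : V) :
    Fin (c.size i j k) :=
  c.enc i j k (fun s => x s j) (fun i' _ k' => (c.msg x i' j k', c.msg x i' k' j))
termination_by i.val

/-- The estimate produced at node `j`. -/
def estimate (c : NetworkCode V α β t n) (x : Fin n → V → α) (j : V) : Fin n → β :=
  c.dec j (fun s => x s j) (fun i' k' => (c.msg x i' j k', c.msg x i' k' j))

end NetworkCode

namespace NetworkProblem

variable {V α β : Type} [MeasurableSpace α] (Q : NetworkProblem V α β)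

/-- Probability of block error at node `j`, for `n` i.i.d. samples of the sources. -/
noncomputable def blockError {t n : ℕ} (c : NetworkCode V α β t n) (j : V) : ℝ :=
  (Measure.pi (fun _ : Fin n => Q.source)).real
    {x | c.estimate x j ≠ fun s => Q.target j (x s)}

/-- `c` obeys the interaction protocol `P`: in round `i` only links of the network that
belong to `P i` may be active (carry a message that is not null). -/
def Follows {t n : ℕ} (P : Fin t → Set (V × V)) (c : NetworkCode V α β t n) : Prop :=
  ∀ i j k, ¬ ((j, k) ∈ Q.links ∧ (j, k) ∈ P i) → c.size i j k = 1

/-- The rate tuple `R` (`R i (j, k)` bits per sample on the link `(j, k)` in round `i`; the values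
of `R i` off the links play no role) is admissible under the interaction protocol `P`. -/
def Admissible {t : ℕ} (P : Fin t → Set (V × V)) (R : Fin t → V × V → ℝ) : Prop :=
  ∀ ε : ℝ, 0 < ε → ∃ N : ℕ, ∀ n : ℕ, N < n → ∃ c : NetworkCode V α β t n,
    Q.Follows P c ∧
    (∀ i, ∀ e ∈ Q.links, 1 / (n : ℝ) * Real.logb 2 (c.size i e.1 e.2) ≤ R i e + ε) ∧
    ∀ j, Q.blockError c j ≤ ε

/-- The sum-total-rate: the total rate over all rounds and all links. -/
def sumTotalRate {t : ℕ} (R : Fin t → V × V → ℝ) : ℝ :=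
  ∑ i, ∑ e ∈ Q.links, R i e

/-- The sum-total-rates of the rate tuples which are admissible under the protocol `P`. -/
def achievableSums {t : ℕ} (P : Fin t → Set (V × V)) : Set ℝ :=
  {r | ∃ R : Fin t → V × V → ℝ, Q.Admissible P R ∧ Q.sumTotalRate R = r}

/-- The unrestricted `t`-round protocol: every link of the network may be active in every round. -/
def fullProtocol (t : ℕ) : Fin t → Set (V × V) := fun _ => Q.links

/-- The function computation is feasible in `t` rounds. -/
def Feasible (t : ℕ) : Prop := ∃ R, Q.Admissible (Q.fullProtocol t) R

/-- The minimum sum-total-rate `R_{sum,t}` over all `t`-round interactive codes. -/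
noncomputable def minSumRate (t : ℕ) : ℝ := sInf (Q.achievableSums (Q.fullProtocol t))

end NetworkProblem

/-- The law of one fair bit, `Ber(1/2)`, where `0` is `false` and `1` is `true`. -/
noncomputable def fairBit : Measure Bool := (PMF.uniformOfFintype Bool).toMeasure

/-- The star network with nodes `0, …, m - 1` and centre `0`. The sources are independent fair bits
and only the centre has to compute a nontrivial function, the minimum of all `m` bits
(in `Bool`, `false < true`). The links join the centre to each other node, in both directions. -/
noncomputable def starMin (m : ℕ) : NetworkProblem (Fin m) Bool Bool where
  source := Measure.pi (fun _ => fairBit)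
  isProbabilityMeasure_source := by unfold fairBit; infer_instance
  target := fun j x => if j.val = 0 then Finset.univ.inf x else false
  links := Finset.univ.filter
    (fun e => (e.1.val ≠ 0 ∧ e.2.val = 0) ∨ (e.1.val = 0 ∧ e.2.val ≠ 0))

/-- The non-interactive protocol: in each of the `t` rounds, exactly the links from the leaves to
the centre may be active. -/
def leavesToCentre (m t : ℕ) : Fin t → Set (Fin m × Fin m) :=
  fun _ => {e | e.1.val ≠ 0 ∧ e.2.val = 0}

/-- The interactive protocol with rounds `0, …, 2m - 3`. For `1 ≤ i ≤ m - 1`, only the link from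
the centre `0` to the leaf `i` may be active in round `2i - 2`, and only the link from the leaf `i`
to the centre may be active in round `2i - 1`. -/
def visitLeaves (m : ℕ) : Fin (2 * m - 2) → Set (Fin m × Fin m) :=
  fun r => {e | if r.val % 2 = 0 then e.1.val = 0 ∧ e.2.val = r.val / 2 + 1
    else e.1.val = r.val / 2 + 1 ∧ e.2.val = 0}

/-- Binary entropy in bits. -/
noncomputable def binEntropyBits (p : ℝ) : ℝ := Real.binEntropy p / Real.log 2

/-- The rates of the interactive scheme: `binEntropyBits (2 ^ (-i))` on the link from the centre to the leaf `i`
in round `2i - 2`, and `2 ^ (-i)` on the link back in round `2i - 1`; zero otherwise. -/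
noncomputable def visitRates (m : ℕ) : Fin (2 * m - 2) → Fin m × Fin m → ℝ :=
  fun r => (visitLeaves m r).indicator fun _ =>
    if r.val % 2 = 0 then binEntropyBits (1 / 2 ^ (r.val / 2 + 1)) else 1 / 2 ^ (r.val / 2 + 1)

/-! Lower bound without interaction. If no leaf reacts to what it receives, the message of leaf `j`
depends on its own block alone. The minimum at time `s` equals the bit of `j` whenever all other
bits at time `s` are 1, and forcing this costs only a factor `2 ^ m` in error probability, whatever
the blocklength. So for each `s` there is a context of the other sources in which the centre's
estimate reads off that bit with error at most `2 ^ m * ε`. The message does not depend on the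
context, so a different one may be used for each `s`. The message is thus a lossy description of `n`
fair bits with vanishing Hamming distortion, and needs about `n` bits (`log_card_ge_of_distortion`,
`sum_log_size_ge`). Summing over the leaves gives `m - 1`, which sending raw blocks attains.

Upper bound with interaction. The centre visits the leaves in turn and keeps the set of times at
which all bits seen so far are 1. Before leaf `i` is visited this set has density about `2 ^ (-i)`.
Describing it to the leaf costs the entropy of that density, and the leaf replies with one bit per
element. Chernoff's bound (`card_onesUpTo_gt_le`) and a count of small subsets
(`logb_card_subsetsOfCardLE_le`) make this precise. The costs decay like `i * 2 ^ (-i)`, so their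
sum stays bounded in `m`. -/

lemma fairBit_singleton (b : Bool) : fairBit {b} = 2⁻¹ := by
  rw [fairBit, PMF.toMeasure_apply_singleton _ _ (measurableSet_singleton b)]
  simp

instance isProbabilityMeasure_fairBit : IsProbabilityMeasure fairBit := by
  unfold fairBit; infer_instance

/-- Source blocks are uniform on `2 ^ (n * m)` points, so every probability below becomes a count.
-/
lemma source_block_real {n m : ℕ} (E : Finset (Fin n → Fin m → Bool)) :
    (Measure.pi (fun _ : Fin n => (starMin m).source)).real (E : Set _)
      = (E.card : ℝ) / 2 ^ (n * m) := by
  change (Measure.pi (fun _ : Fin n => Measure.pi (fun _ : Fin m => fairBit))).real _ = _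
  rw [← sum_measureReal_singleton]
  have h : ∀ x : Fin n → Fin m → Bool,
      (Measure.pi (fun _ : Fin n => Measure.pi (fun _ : Fin m => fairBit))).real {x}
        = 1 / 2 ^ (n * m) := by
    intro x
    simp [measureReal_def, Measure.pi_singleton, fairBit_singleton, ← pow_mul, mul_comm]
  simp only [h, Finset.sum_const, nsmul_eq_mul]
  ring

/-! ### Dependence of messages on sources; non-interactive codes -/

namespace NetworkCode

variable {V α β : Type} {t n : ℕ}

/-- A node's sent messages carry no information beyond its block and what it received: by induction
on the round they are recomputable from these. -/
lemma msg_congr_of_received (c : NetworkCode V α β t n) {x x' : Fin n → V → α} {j : V}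
    (hx : ∀ s, x s j = x' s j) (h : ∀ i k, c.msg x i k j = c.msg x' i k j) (i : Fin t) (k : V) :
    c.msg x i j k = c.msg x' i j k := by
  induction hi : i.val using Nat.strong_induction_on generalizing i k with
  | _ a ih =>
    subst hi
    rw [msg, msg]
    have h1 : (fun s => x s j) = fun s => x' s j := funext hx
    rw [h1]
    congr 1
    funext i' hi' k'
    rw [ih i' hi' i' k' rfl, h i' k']

lemma estimate_congr_of_received (c : NetworkCode V α β t n) {x x' : Fin n → V → α} {j : V}
    (hx : ∀ s, x s j = x' s j) (h : ∀ i k, c.msg x i k j = c.msg x' i k j) :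
    c.estimate x j = c.estimate x' j := by
  have h1 : (fun s => x s j) = fun s => x' s j := funext hx
  rw [estimate, estimate, h1]
  congr 1
  funext i' k'
  rw [c.msg_congr_of_received hx h i' k', h i' k']

/-- Nodes `j ≠ z` encode their own block only, without using what they receive. -/
def NonInteractive (c : NetworkCode V α β t n) (z : V) : Prop :=
  ∀ j, j ≠ z → ∀ x x' : Fin n → V → α, (∀ s, x s j = x' s j) →
    ∀ i k, c.msg x i j k = c.msg x' i j k

lemma nonInteractive_of_one_round (c : NetworkCode V α β 1 n) (z : V) : c.NonInteractive z := by
  intro j _ x x' hx i k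
  have h1 : (fun s => x s j) = fun s => x' s j := funext hx
  rw [msg, msg, h1]
  congr 1
  funext i' hi'
  omega

lemma nonInteractive_of_size_eq_one (c : NetworkCode V α β t n) (z : V)
    (h : ∀ i j k, k ≠ z → c.size i j k = 1) : c.NonInteractive z := by
  intro j hj x x' hx i k
  refine c.msg_congr_of_received hx (fun i k => ?_) i k
  have := h i k j hj
  apply Fin.ext
  have h1 := (c.msg x i k j).isLt
  have h2 := (c.msg x' i k j).isLt
  omega

end NetworkCode

/-! ### Converse for lossy coding of fair bits -/

section Distortion

variable {n : ℕ}

lemma sum_exp_hammingDist (c : ℝ) (a : Fin n → Bool) :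
    ∑ u : Fin n → Bool, Real.exp (-c * hammingDist u a) = (1 + Real.exp (-c)) ^ n := by
  have h : ∀ u : Fin n → Bool, Real.exp (-c * hammingDist u a)
      = ∏ s, if u s = a s then 1 else Real.exp (-c) := by
    intro u
    rw [Finset.prod_ite, Finset.prod_const_one, one_mul, Finset.prod_const, ← Real.exp_nat_mul,
      hammingDist, mul_comm]
  simp_rw [h]
  have := Finset.prod_univ_sum (fun _ : Fin n => (Finset.univ : Finset Bool))
    (fun s b => if b = a s then (1 : ℝ) else Real.exp (-c))
  rw [Fintype.piFinset_univ] at this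
  rw [← this]
  have h2 : ∀ s : Fin n, ∑ b : Bool, (if b = a s then (1 : ℝ) else Real.exp (-c))
      = 1 + Real.exp (-c) := by
    intro s; cases a s <;> simp [add_comm]
  simp only [h2, Finset.prod_const, Finset.card_univ, Fintype.card_fin]

/-- Converse to lossy coding of fair bits under Hamming distortion. -/
lemma log_card_ge_of_distortion {M : Type} [Fintype M] (f : (Fin n → Bool) → M)
    (g : M → Fin n → Bool) {δ c : ℝ} (hc : 0 ≤ c)
    (h : ∀ s, ((Finset.univ.filter fun u => g (f u) s ≠ u s).card : ℝ) ≤ δ * 2 ^ n) :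
    n * (Real.log 2 - c * δ - Real.exp (-c)) ≤ Real.log (Fintype.card M) := by
  have hM : 0 < Fintype.card M := Fintype.card_pos_iff.2 ⟨f fun _ => false⟩
  have hd : ∑ u : Fin n → Bool, (hammingDist u (g (f u)) : ℝ) ≤ n * δ * 2 ^ n := by
    have : ∀ u : Fin n → Bool, (hammingDist u (g (f u)) : ℝ)
        = ∑ s, if g (f u) s ≠ u s then (1 : ℝ) else 0 := by
      intro u
      rw [hammingDist, Finset.sum_boole]
      simp only [ne_comm]
    simp_rw [this]
    rw [Finset.sum_comm]
    calc _ ≤ ∑ s : Fin n, δ * 2 ^ n := by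
          refine Finset.sum_le_sum fun s _ => ?_
          rw [Finset.sum_boole]
          exact h s
      _ = _ := by simp; ring
  have h1 : 2 ^ n * Real.exp (-c * (n * δ))
      ≤ ∑ u : Fin n → Bool, Real.exp (-c * hammingDist u (g (f u))) := by
    -- Tangent line of the exponential at `n * δ`; summed over `u`, this is Jensen's inequality.
    have key : ∀ u : Fin n → Bool,
        Real.exp (-c * (n * δ)) * (1 - c * (hammingDist u (g (f u)) - n * δ))
          ≤ Real.exp (-c * hammingDist u (g (f u))) := by
      intro u
      have e : Real.exp (-c * hammingDist u (g (f u))) = Real.exp (-c * (n * δ)) *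
          Real.exp (-c * (hammingDist u (g (f u)) - n * δ)) := by
        rw [← Real.exp_add]; ring_nf
      rw [e]
      refine mul_le_mul_of_nonneg_left ?_ (Real.exp_nonneg _)
      have := Real.add_one_le_exp (-c * (hammingDist u (g (f u)) - n * δ))
      linarith
    refine le_trans ?_ (Finset.sum_le_sum fun u _ => key u)
    rw [← Finset.mul_sum, mul_comm]
    refine mul_le_mul_of_nonneg_left ?_ (Real.exp_nonneg _)
    rw [Finset.sum_sub_distrib, ← Finset.mul_sum, Finset.sum_sub_distrib]
    simp only [Finset.sum_const, Finset.card_univ, Fintype.card_pi, Fintype.card_bool,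
      Finset.prod_const, Fintype.card_fin, nsmul_eq_mul]
    push_cast
    nlinarith
  -- Summing over all codewords instead of the chosen one removes `f`; each codeword then
  -- contributes the same amount.
  have h2 : ∑ u : Fin n → Bool, Real.exp (-c * hammingDist u (g (f u)))
      ≤ Fintype.card M * (1 + Real.exp (-c)) ^ n := by
    calc _ ≤ ∑ u : Fin n → Bool, ∑ a : M, Real.exp (-c * hammingDist u (g a)) :=
          Finset.sum_le_sum fun u _ => Finset.single_le_sum
            (f := fun a => Real.exp (-c * hammingDist u (g a)))
            (fun a _ => Real.exp_nonneg _) (Finset.mem_univ (f u))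
      _ = _ := by
          rw [Finset.sum_comm]
          simp only [sum_exp_hammingDist, Finset.sum_const, Finset.card_univ, nsmul_eq_mul]
  have h3 := Real.log_le_log (by positivity) (h1.trans h2)
  have hpos : 0 < 1 + Real.exp (-c) := by positivity
  rw [Real.log_mul (by positivity) (Real.exp_ne_zero _),
    Real.log_mul (by positivity) (by positivity), Real.log_exp, Real.log_pow, Real.log_pow] at h3
  have h4 := Real.log_le_sub_one_of_pos hpos
  have h5 : (n : ℝ) * Real.log (1 + Real.exp (-c)) ≤ n * Real.exp (-c) :=
    mul_le_mul_of_nonneg_left (by linarith) (by positivity)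
  linarith

end Distortion

lemma starMin_blockError_eq {m t n : ℕ} (c : NetworkCode (Fin m) Bool Bool t n) (j : Fin m) :
    (starMin m).blockError c j = ((Finset.univ.filter fun x : Fin n → Fin m → Bool =>
      c.estimate x j ≠ fun s => (starMin m).target j (x s)).card : ℝ) / 2 ^ (n * m) := by
  rw [← source_block_real, NetworkProblem.blockError]
  congr 1
  ext x
  simp

/-! ### Each leaf of a non-interactive code sends one bit per sample -/

section Converse

variable {m t n : ℕ}

/-- The block `y` with the samples of the source `j` replaced by `u`. -/
def replaceSource (j : Fin m) (y : Fin n → Fin m → Bool) (u : Fin n → Bool) :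
    Fin n → Fin m → Bool :=
  fun s => Function.update (y s) j (u s)

/-- The modified block forgets only the sample `y s` and the column `j` of `y`; recording these
makes the map injective and gives the factors `2 ^ m` and `2 ^ n`. Averaging over `y` then yields a
context with few bad `u`. -/
lemma card_replaceSource_le (j : Fin m) (s : Fin n) (E : Finset (Fin n → Fin m → Bool)) :
    ∑ y : Fin n → Fin m → Bool, (Finset.univ.filter fun u : Fin n → Bool =>
      replaceSource j (Function.update y s fun _ => true) u ∈ E).card ≤ E.card * (2 ^ m * 2 ^ n) := by
  classical
  rw [← Finset.card_sigma]
  have hc : (E ×ˢ (Finset.univ : Finset ((Fin m → Bool) × (Fin n → Bool)))).card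
      = E.card * (2 ^ m * 2 ^ n) := by
    simp [Finset.card_product, Finset.card_univ]
  rw [← hc]
  refine Finset.card_le_card_of_injOn
    (fun p => (replaceSource j (Function.update p.1 s fun _ => true) p.2,
      (p.1 s, fun s' => p.1 s' j))) ?_ ?_
  · rintro ⟨y, u⟩ h
    simpa using h
  · rintro ⟨y, u⟩ _ ⟨y', u'⟩ _ h
    simp only [Prod.mk.injEq] at h
    obtain ⟨h1, h2, h3⟩ := h
    have hu : u = u' := by
      funext s'
      have := congrFun (congrFun h1 s') j
      simpa [replaceSource] using this
    have hy : y = y' := by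
      funext s' v
      by_cases hs : s' = s
      · rw [hs, h2]
      by_cases hv : v = j
      · rw [hv]; exact congrFun h3 s'
      have := congrFun (congrFun h1 s') v
      simpa [replaceSource, hs, hv] using this
    rw [hu, hy]

lemma starMin_target_replaceSource {z j : Fin m} (hz : z.val = 0) (y : Fin n → Fin m → Bool)
    (u : Fin n → Bool) (s : Fin n) :
    (starMin m).target z (replaceSource j (Function.update y s fun _ => true) u s) = u s := by
  simp only [starMin, hz, if_true, replaceSource, Function.update_self]
  cases hu : u s
  · refine le_bot_iff.1 ((Finset.inf_le (Finset.mem_univ j)).trans ?_)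
    simp
  · refine top_le_iff.1 (Finset.le_inf fun v _ => ?_)
    by_cases h : v = j
    · subst h; simp
    · simp [h]

/-- In a non-interactive code with small block error each leaf has to send about one bit
per sample. -/
lemma sum_log_size_ge {c : NetworkCode (Fin m) Bool Bool t n} {z j : Fin m} (hz : z.val = 0)
    (hj : j ≠ z) (hc : c.NonInteractive z) (hzz : ∀ i, c.size i z z = 1) {ε a : ℝ} (ha : 0 ≤ a)
    (hε : (starMin m).blockError c z ≤ ε) :
    n * (Real.log 2 - a * (2 ^ m * ε) - Real.exp (-a)) ≤ ∑ i, Real.log (c.size i j z) := by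
  classical
  set E := Finset.univ.filter fun x : Fin n → Fin m → Bool =>
      c.estimate x z ≠ fun s => (starMin m).target z (x s) with hE
  have hEc : (E.card : ℝ) ≤ ε * 2 ^ (n * m) := by
    rw [starMin_blockError_eq, div_le_iff₀ (by positivity)] at hε
    exact hε
  have hy : ∀ s : Fin n, ∃ y : Fin n → Fin m → Bool,
      ((Finset.univ.filter fun u : Fin n → Bool =>
        replaceSource j (Function.update y s fun _ => true) u ∈ E).card : ℝ)
        ≤ 2 ^ m * ε * 2 ^ n := by
    intro s
    have h1 : ∑ y : Fin n → Fin m → Bool, ((Finset.univ.filter fun u : Fin n → Bool =>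
        replaceSource j (Function.update y s fun _ => true) u ∈ E).card : ℝ)
        ≤ ∑ y : Fin n → Fin m → Bool, 2 ^ m * ε * 2 ^ n := by
      have h2 : ∑ y : Fin n → Fin m → Bool, ((Finset.univ.filter fun u : Fin n → Bool =>
        replaceSource j (Function.update y s fun _ => true) u ∈ E).card : ℝ)
        ≤ E.card * (2 ^ m * 2 ^ n) := by exact_mod_cast card_replaceSource_le j s E
      refine h2.trans ((mul_le_mul_of_nonneg_right hEc (by positivity)).trans (le_of_eq ?_))
      simp [Finset.card_univ, ← pow_mul, mul_comm m n]
      ring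
    obtain ⟨y, -, h⟩ := Finset.exists_le_of_sum_le Finset.univ_nonempty h1
    exact ⟨y, h⟩
  choose y hy using hy
  -- The all-ones context is arbitrary: by non-interactivity the message is the same in any other.
  let f : (Fin n → Bool) → ∀ i, Fin (c.size i j z) :=
    fun u i => c.msg (replaceSource j (fun _ _ => true) u) i j z
  -- Bit `s` is decoded in its own context `y s`. `Function.invFun` picks some block with the given
  -- message; the centre cannot tell it from the true one.
  let g : (∀ i, Fin (c.size i j z)) → Fin n → Bool := fun a s =>
    c.estimate (replaceSource j (Function.update (y s) s fun _ => true)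
      (Function.invFun f a)) z s
  have hfg : ∀ u s, g (f u) s
      = c.estimate (replaceSource j (Function.update (y s) s fun _ => true) u) z s := by
    intro u s
    have hinv : f (Function.invFun f (f u)) = f u := Function.invFun_eq ⟨u, rfl⟩
    refine congrFun (c.estimate_congr_of_received (fun s' => ?_) fun i k => ?_) s
    · simp [replaceSource, hj.symm]
    by_cases hk : k = z
    · subst hk
      apply Fin.ext
      have h1 := (c.msg (replaceSource j (Function.update (y s) s fun _ => true)
        (Function.invFun f (f u))) i k k).isLt
      have h2 := (c.msg (replaceSource j (Function.update (y s) s fun _ => true) u) i k k).isLt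
      have := hzz i
      omega
    by_cases hkj : k = j
    · subst hkj
      have h1 := congrFun hinv i
      have h2 : ∀ w, c.msg (replaceSource k (Function.update (y s) s fun _ => true) w) i k z
          = f w i := fun w => hc k hk _ _ (fun s' => by simp [replaceSource]) i z
      rw [h2, h2, h1]
    · exact hc k hk _ _ (fun s' => by simp [replaceSource, hkj]) i z
  have := log_card_ge_of_distortion f g (δ := 2 ^ m * ε) ha fun s => by
    refine le_trans ?_ (hy s)
    refine Nat.cast_le.2 (Finset.card_le_card fun u hu => ?_)
    simp only [Finset.mem_filter, Finset.mem_univ, true_and, hE] at hu ⊢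
    intro h
    apply hu
    rw [hfg, h]
    exact starMin_target_replaceSource hz _ _ _
  refine this.trans (le_of_eq ?_)
  rw [Fintype.card_pi]
  simp only [Fintype.card_fin]
  push_cast
  rw [Real.log_prod]
  intro i _
  exact_mod_cast (c.size_pos i j z).ne'

lemma mem_starMin_links {e : Fin m × Fin m} : e ∈ (starMin m).links ↔
    (e.1.val ≠ 0 ∧ e.2.val = 0) ∨ (e.1.val = 0 ∧ e.2.val ≠ 0) := by
  simp [starMin]

/-- Alphabets are non-empty, so the rate is at least `-ε` for each `ε`. This bounds the infimum from
below and lets the converse discard the links leaving the centre. -/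
lemma admissible_nonneg {V α β : Type} [MeasurableSpace α] {Q : NetworkProblem V α β}
    {P : Fin t → Set (V × V)} {R : Fin t → V × V → ℝ} (h : Q.Admissible P R) (i : Fin t)
    {e : V × V} (he : e ∈ Q.links) : 0 ≤ R i e := by
  refine le_of_forall_pos_le_add fun ε hε => ?_
  obtain ⟨N, hN⟩ := h ε hε
  obtain ⟨c, -, h, -⟩ := hN (N + 1) N.lt_succ_self
  refine le_trans (mul_nonneg (by positivity) (Real.logb_nonneg one_lt_two ?_)) (h i e he)
  exact_mod_cast c.size_pos i e.1 e.2

lemma sumTotalRate_nonneg {V α β : Type} [MeasurableSpace α] {Q : NetworkProblem V α β}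
    {P : Fin t → Set (V × V)} {R : Fin t → V × V → ℝ} (h : Q.Admissible P R) :
    0 ≤ Q.sumTotalRate R :=
  Finset.sum_nonneg fun i _ => Finset.sum_nonneg fun _ he => admissible_nonneg h i he

lemma one_le_leaf_rate {P : Fin t → Set (Fin m × Fin m)} {R : Fin t → Fin m × Fin m → ℝ}
    (hR : (starMin m).Admissible P R) {z j : Fin m} (hz : z.val = 0) (hj : j ≠ z)
    (hP : ∀ n, ∀ c : NetworkCode (Fin m) Bool Bool t n, (starMin m).Follows P c →
      c.NonInteractive z) : 1 ≤ ∑ i, R i (j, z) := by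
  have hl : 0 < Real.log 2 := Real.log_pos one_lt_two
  have hlink : (j, z) ∈ (starMin m).links :=
    mem_starMin_links.2 (Or.inl ⟨fun h => hj (Fin.ext (h.trans hz.symm)), hz⟩)
  have key : ∀ a : ℝ, 0 ≤ a → ∀ ε : ℝ, 0 < ε →
      Real.log 2 - Real.exp (-a) ≤
        (∑ i, R i (j, z)) * Real.log 2 + ε * (t * Real.log 2 + a * 2 ^ m) := by
    intro a ha ε hε
    obtain ⟨N, hN⟩ := hR ε hε
    obtain ⟨c, hf, hr, he⟩ := hN (N + 1) N.lt_succ_self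
    have hn : (0 : ℝ) < ((N + 1 : ℕ) : ℝ) := by positivity
    have h1 := sum_log_size_ge hz hj (hP _ c hf)
      (fun i => hf i z z fun h => by simpa [hz] using mem_starMin_links.1 h.1) ha (he z)
    have h2 : ∑ i, Real.log (c.size i j z)
        ≤ (N + 1 : ℕ) * ((∑ i, R i (j, z)) * Real.log 2 + t * ε * Real.log 2) := by
      have : ∀ i, Real.log (c.size i j z)
          ≤ (N + 1 : ℕ) * ((R i (j, z) + ε) * Real.log 2) := by
        intro i
        have := hr i _ hlink
        simp only [Real.logb] at this
        rw [one_div, inv_mul_le_iff₀ hn, div_le_iff₀ hl] at this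
        linarith
      refine (Finset.sum_le_sum fun i _ => this i).trans (le_of_eq ?_)
      rw [← Finset.mul_sum, ← Finset.sum_mul, Finset.sum_add_distrib]
      simp only [Finset.sum_const, Finset.card_univ, Fintype.card_fin, nsmul_eq_mul]
      ring
    have h3 := le_of_mul_le_mul_left (h1.trans h2) hn
    linarith
  -- The order of limits matters: `ε → 0` with `a` fixed kills `a * 2 ^ m * ε`, and only then `a →
  -- ∞`.
  have key2 : ∀ a : ℝ, 0 ≤ a → Real.log 2 - Real.exp (-a) ≤ (∑ i, R i (j, z)) * Real.log 2 := by
    intro a ha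
    have ht : Tendsto (fun ε : ℝ => (∑ i, R i (j, z)) * Real.log 2
        + ε * (t * Real.log 2 + a * 2 ^ m)) (nhdsWithin 0 (Set.Ioi 0))
        (nhds ((∑ i, R i (j, z)) * Real.log 2 + 0 * (t * Real.log 2 + a * 2 ^ m))) :=
      (Continuous.tendsto (by fun_prop) 0).mono_left nhdsWithin_le_nhds
    rw [zero_mul, add_zero] at ht
    exact ge_of_tendsto ht (eventually_nhdsWithin_of_forall fun ε hε => key a ha ε hε)
  have ht : Tendsto (fun a : ℝ => Real.log 2 - Real.exp (-a)) atTop (nhds (Real.log 2 - 0)) :=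
    tendsto_const_nhds.sub (Real.tendsto_exp_neg_atTop_nhds_zero)
  rw [sub_zero] at ht
  have := le_of_tendsto ht ((eventually_ge_atTop 0).mono key2)
  exact (le_mul_iff_one_le_left hl).1 this

lemma starMin_sumTotalRate_ge {P : Fin t → Set (Fin m × Fin m)}
    {R : Fin t → Fin m × Fin m → ℝ} (hm : 1 ≤ m) (hR : (starMin m).Admissible P R)
    (hP : ∀ n, ∀ c : NetworkCode (Fin m) Bool Bool t n, (starMin m).Follows P c →
      c.NonInteractive ⟨0, hm⟩) : (m : ℝ) - 1 ≤ (starMin m).sumTotalRate R := by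
  set z : Fin m := ⟨0, hm⟩ with hz
  calc (m : ℝ) - 1 = ∑ j ∈ Finset.univ.erase z, (1 : ℝ) := by
        rw [Finset.sum_const, Finset.card_erase_of_mem (Finset.mem_univ z)]
        simp [hm]
    _ ≤ ∑ j ∈ Finset.univ.erase z, ∑ i, R i (j, z) :=
        Finset.sum_le_sum fun j hj => one_le_leaf_rate hR rfl (Finset.ne_of_mem_erase hj) hP
    _ = ∑ i, ∑ j ∈ Finset.univ.erase z, R i (j, z) := Finset.sum_comm
    _ ≤ _ := by
        refine Finset.sum_le_sum fun i _ => ?_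
        rw [← Finset.sum_image (f := R i) (g := fun j => (j, z)) (by
          intro a _ b _ h; exact (Prod.mk.inj h).1)]
        refine Finset.sum_le_sum_of_subset_of_nonneg ?_ fun e he _ => admissible_nonneg hR i he
        intro e he
        obtain ⟨j, hj, rfl⟩ := Finset.mem_image.1 he
        exact mem_starMin_links.2 (Or.inl
          ⟨fun h => Finset.ne_of_mem_erase hj (Fin.ext h), rfl⟩)

end Converse

/-! ### Numbering the elements of a finite set -/

section Indexing

variable {γ : Type} [DecidableEq γ]

/-- The index of `a` in an enumeration of `T`, and `0` if `a ∉ T`. -/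
noncomputable def indexIn (T : Finset γ) (a : γ) : ℕ :=
  if h : a ∈ T then (T.equivFin ⟨a, h⟩).val else 0

/-- The element of `T` with index `i`. -/
noncomputable def elemAt [Inhabited γ] (T : Finset γ) (i : ℕ) : γ :=
  if h : i < T.card then (T.equivFin.symm ⟨i, h⟩).val else default

lemma indexIn_lt {T : Finset γ} {a : γ} (h : a ∈ T) : indexIn T a < T.card := by
  simp [indexIn, h]

lemma elemAt_indexIn [Inhabited γ] {T : Finset γ} {a : γ} (h : a ∈ T) : elemAt T (indexIn T a) = a := by
  simp [indexIn, elemAt, h]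

end Indexing

/-! ### Codes with messages in `ℕ`, free of dependent alphabets -/

section NatCode

variable {m t n : ℕ}

/-- A code whose nodes, rounds and messages are given by natural numbers; messages are reduced
modulo the size of their alphabet, and the encoders only look at the received messages
(`h r v` is the message received from the node `v` in round `r`). -/
def natCode (m t n : ℕ) (size : ℕ → ℕ → ℕ → ℕ) (hs : ∀ r j k, 0 < size r j k)
    (enc : ℕ → ℕ → (Fin n → Bool) → (ℕ → ℕ → ℕ) → ℕ)
    (dec : ℕ → (Fin n → Bool) → (ℕ → ℕ → ℕ) → Fin n → Bool) :
    NetworkCode (Fin m) Bool Bool t n where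
  size r j k := size r j k
  size_pos r j k := hs r j k
  enc r j k x h := ⟨enc r j x (fun r' v => if hr : ∃ ht : r' < t, (⟨r', ht⟩ : Fin t) < r ∧ v < m
    then (h ⟨r', hr.1⟩ hr.2.1 ⟨v, hr.2.2⟩).2.val else 0) % size r j k, Nat.mod_lt _ (hs _ _ _)⟩
  dec j x h := dec j x (fun r v => if hr : r < t ∧ v < m
    then (h ⟨r, hr.1⟩ ⟨v, hr.2⟩).2.val else 0)

/-- The message from node `j` to node `k` in round `r`, and `0` if these are out of range. -/
def NetworkCode.natMsg (c : NetworkCode (Fin m) Bool Bool t n) (x : Fin n → Fin m → Bool)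
    (r j k : ℕ) : ℕ :=
  if h : r < t ∧ j < m ∧ k < m then (c.msg x ⟨r, h.1⟩ ⟨j, h.2.1⟩ ⟨k, h.2.2⟩).val else 0

variable {size : ℕ → ℕ → ℕ → ℕ} {hs : ∀ r j k, 0 < size r j k}
  {enc : ℕ → ℕ → (Fin n → Bool) → (ℕ → ℕ → ℕ) → ℕ}
  {dec : ℕ → (Fin n → Bool) → (ℕ → ℕ → ℕ) → Fin n → Bool}

lemma natCode_natMsg (x : Fin n → Fin m → Bool) {r k : ℕ} (j : Fin m) (hr : r < t) (hk : k < m) :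
    (natCode m t n size hs enc dec).natMsg x r j k = enc r j (fun s => x s j)
      (fun r' v => if r' < r then (natCode m t n size hs enc dec).natMsg x r' v j else 0)
        % size r j k := by
  rw [NetworkCode.natMsg, dif_pos ⟨hr, j.isLt, hk⟩, NetworkCode.msg]
  simp only [natCode]
  congr 2
  funext r' v
  by_cases h : r' < r
  · by_cases hv : v < m
    · have : r' < t := h.trans hr
      simp [h, hv, this, NetworkCode.natMsg]
    · simp [hv, NetworkCode.natMsg]
  · simp [h]

lemma natCode_estimate (x : Fin n → Fin m → Bool) (j : Fin m) :
    (natCode m t n size hs enc dec).estimate x j = dec j (fun s => x s j)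
      (fun r v => (natCode m t n size hs enc dec).natMsg x r v j) := by
  rw [NetworkCode.estimate]
  simp only [natCode]
  congr 1
  funext r v
  by_cases h : r < t ∧ v < m
  · simp [h, NetworkCode.natMsg]
  · have : ¬ (r < t ∧ v < m ∧ j.val < m) := fun h' => h ⟨h'.1, h'.2.1⟩
    rw [dif_neg h, NetworkCode.natMsg, dif_neg this]

end NatCode

/-! ### Sending raw blocks attains `m - 1` -/

section NonInteractiveScheme

variable {m t : ℕ}

/-- In the first round each leaf sends its whole block. -/
noncomputable def forwardCode (m t n : ℕ) : NetworkCode (Fin m) Bool Bool t n :=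
  natCode m t n (fun r j k => if r = 0 ∧ j ≠ 0 ∧ k = 0 then 2 ^ n else 1)
    (fun r j k => by positivity)
    (fun _ _ x _ => indexIn Finset.univ x)
    (fun j x h s => if j = 0 then
      Finset.univ.inf (fun v : Fin m => if v.val = 0 then x s else elemAt (γ := Fin n → Bool) Finset.univ (h 0 v) s)
      else false)

lemma forwardCode_estimate (n : ℕ) (ht : 1 ≤ t) (x : Fin n → Fin m → Bool) (j : Fin m) :
    (forwardCode m t n).estimate x j = fun s => (starMin m).target j (x s) := by
  rw [forwardCode, natCode_estimate]
  funext s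
  by_cases hj : j.val = 0
  · simp only [hj, if_true, starMin]
    congr 1
    funext v
    by_cases hv : v.val = 0
    · rw [if_pos hv]
      congr 1
      exact Fin.ext (hj.trans hv.symm)
    · have hlt : indexIn Finset.univ (fun s => x s v) < 2 ^ n := by
        refine (indexIn_lt (Finset.mem_univ _)).trans_eq ?_
        simp [Finset.card_univ]
      rw [if_neg hv, natCode_natMsg x v ht (j.pos), if_pos ⟨rfl, hv, rfl⟩,
        Nat.mod_eq_of_lt hlt, elemAt_indexIn (Finset.mem_univ _)]
  · simp [hj, starMin]

lemma admissible_forward (ht : 1 ≤ t) : (starMin m).Admissible (leavesToCentre m t)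
    (fun r e => if r.val = 0 ∧ e.1.val ≠ 0 then 1 else 0) := by
  intro ε hε
  refine ⟨0, fun n hn => ⟨forwardCode m t n, ?_, ?_, ?_⟩⟩
  · intro i j k h
    simp only [forwardCode, natCode]
    refine if_neg fun h' => h ⟨mem_starMin_links.2 (Or.inl h'.2), h'.2⟩
  · intro i e _
    have hn' : (0 : ℝ) < n := by exact_mod_cast hn
    simp only [forwardCode, natCode]
    split_ifs with h1 h2 h2
    · push_cast
      rw [Real.logb_pow, Real.logb_self_eq_one one_lt_two, mul_one, one_div,
        inv_mul_cancel₀ hn'.ne']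
      linarith
    · exact absurd ⟨h1.1, h1.2.1⟩ h2
    · simp; linarith
    · simp [hε.le]
  · intro j
    rw [starMin_blockError_eq]
    simp [forwardCode_estimate n ht, hε.le]

lemma sum_starMin_links (z : Fin m) (hz : z.val = 0) (f : Fin m × Fin m → ℝ) :
    ∑ e ∈ (starMin m).links, f e
      = ∑ j ∈ Finset.univ.erase z, f (j, z) + ∑ j ∈ Finset.univ.erase z, f (z, j) := by
  classical
  have hne : ∀ j : Fin m, j.val = 0 ↔ j = z := fun j =>
    ⟨fun h => Fin.ext (h.trans hz.symm), fun h => h ▸ hz⟩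
  rw [← Finset.sum_image (f := f) (g := fun j => (j, z)) (by
      intro a _ b _ h; exact (Prod.mk.inj h).1),
    ← Finset.sum_image (f := f) (g := fun j => (z, j)) (by
      intro a _ b _ h; exact (Prod.mk.inj h).2), ← Finset.sum_union]
  · refine Finset.sum_congr ?_ fun _ _ => rfl
    ext ⟨a, b⟩
    simp only [mem_starMin_links, Finset.mem_union, Finset.mem_image, Finset.mem_erase,
      Finset.mem_univ, and_true, hne, Prod.mk.injEq, ne_eq]
    constructor
    · rintro (⟨h1, h2⟩ | ⟨h1, h2⟩)
      · exact Or.inl ⟨a, h1, rfl, h2.symm⟩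
      · exact Or.inr ⟨b, h2, h1.symm, rfl⟩
    · rintro (⟨j, h1, rfl, h2⟩ | ⟨j, h1, h2, rfl⟩)
      · exact Or.inl ⟨h1, h2.symm⟩
      · exact Or.inr ⟨h2.symm, h1⟩
  · rw [Finset.disjoint_left]
    rintro e h1 h2
    obtain ⟨a, ha, rfl⟩ := Finset.mem_image.1 h1
    obtain ⟨b, hb, h⟩ := Finset.mem_image.1 h2
    exact Finset.ne_of_mem_erase ha (Prod.mk.inj h).1.symm

lemma sumTotalRate_forward (hm : 1 ≤ m) (ht : 1 ≤ t) : (starMin m).sumTotalRate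
    (fun (r : Fin t) e => if r.val = 0 ∧ e.1.val ≠ 0 then 1 else 0) = (m : ℝ) - 1 := by
  set z : Fin m := ⟨0, hm⟩ with hz
  rw [NetworkProblem.sumTotalRate, Finset.sum_eq_single (⟨0, ht⟩ : Fin t)]
  · rw [sum_starMin_links z rfl]
    have h1 : ∀ j ∈ Finset.univ.erase z, (if (⟨0, ht⟩ : Fin t).val = 0 ∧ (j, z).1.val ≠ 0
        then (1 : ℝ) else 0) = 1 := fun j hj =>
      if_pos ⟨rfl, fun h => Finset.ne_of_mem_erase hj (Fin.ext h)⟩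
    rw [Finset.sum_congr rfl h1, Finset.sum_const,
      Finset.card_erase_of_mem (Finset.mem_univ z)]
    simp [hz, hm]
  · intro r _ hr
    have : r.val ≠ 0 := fun h => hr (Fin.ext h)
    simp [this]
  · simp

lemma admissible_mono {V α β : Type} [MeasurableSpace α] {Q : NetworkProblem V α β}
    {P P' : Fin t → Set (V × V)} {R : Fin t → V × V → ℝ}
    (h : ∀ i, ∀ e ∈ Q.links, e ∈ P i → e ∈ P' i)
    (hR : Q.Admissible P R) : Q.Admissible P' R := by
  intro ε hε
  obtain ⟨N, hN⟩ := hR ε hε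
  refine ⟨N, fun n hn => ?_⟩
  obtain ⟨c, hc, h2⟩ := hN n hn
  exact ⟨c, fun i j k hjk => hc i j k fun h' => hjk ⟨h'.1, h i _ h'.1 h'.2⟩, h2⟩

lemma isLeast_achievableSums_leavesToCentre (hm : 1 ≤ m) (ht : 1 ≤ t) :
    IsLeast ((starMin m).achievableSums (leavesToCentre m t)) ((m : ℝ) - 1) := by
  refine ⟨⟨_, admissible_forward ht, sumTotalRate_forward hm ht⟩, ?_⟩
  rintro _ ⟨R, hR, rfl⟩
  refine starMin_sumTotalRate_ge hm hR fun n c hc => c.nonInteractive_of_size_eq_one _ ?_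
  exact fun i j k hk => hc i j k fun h => hk (Fin.ext h.2.2)

lemma isLeast_achievableSums_one_round (hm : 1 ≤ m) :
    IsLeast ((starMin m).achievableSums ((starMin m).fullProtocol 1)) ((m : ℝ) - 1) := by
  refine ⟨⟨_, admissible_mono (fun i e he _ => he) (admissible_forward le_rfl),
    sumTotalRate_forward hm le_rfl⟩, ?_⟩
  rintro _ ⟨R, hR, rfl⟩
  exact starMin_sumTotalRate_ge hm hR fun n c _ => c.nonInteractive_of_one_round _

lemma isLeast_feasible (hm : 2 ≤ m) : IsLeast {t : ℕ | (starMin m).Feasible t} 1 := by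
  refine ⟨?_, ?_⟩
  · obtain ⟨R, hR, -⟩ := (isLeast_achievableSums_one_round (m := m) (by omega)).1
    exact ⟨R, hR⟩
  · rintro t ⟨R, hR⟩
    by_contra h
    obtain rfl : t = 0 := by omega
    -- With no rounds a code is vacuously non-interactive, yet its total rate is an empty sum.
    have := starMin_sumTotalRate_ge (by omega) hR fun n c _ _ _ _ _ _ i => i.elim0
    simp only [NetworkProblem.sumTotalRate, Finset.univ_eq_empty, Finset.sum_empty] at this
    have h2 : (2 : ℝ) ≤ m := by exact_mod_cast hm
    linarith

end NonInteractiveScheme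

/-! ### Chernoff's bound and the number of small subsets -/

section Counting

variable {m n : ℕ}

/-- The samples at which all of the sources `0, …, q` are `1`. -/
def onesUpTo (q : ℕ) (x : Fin n → Fin m → Bool) : Finset (Fin n) :=
  Finset.univ.filter fun s => ∀ v : Fin m, v.val ≤ q → x s v = true

lemma card_all_true_up_to {q : ℕ} (hq : q < m) :
    ((Finset.univ.filter fun y : Fin m → Bool => ∀ v : Fin m, v.val ≤ q → y v = true).card : ℝ)
      = 2 ^ m * (1 / 2 ^ (q + 1)) := by
  have h : (Finset.univ.filter fun y : Fin m → Bool => ∀ v : Fin m, v.val ≤ q → y v = true)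
      = Fintype.piFinset fun v : Fin m => if v.val ≤ q then {true} else Finset.univ := by
    ext y
    simp only [Finset.mem_filter, Finset.mem_univ, true_and, Fintype.mem_piFinset]
    refine forall_congr' fun v => ?_
    by_cases hv : v.val ≤ q <;> simp [hv]
  have h2 : ∏ v : Fin m, (if v.val ≤ q then 1 else 2) = 2 ^ (m - (q + 1)) := by
    rw [Fin.prod_univ_eq_prod_range (fun v => if v ≤ q then 1 else 2) m,
      ← Nat.sub_add_cancel hq, add_comm (m - q.succ), Finset.prod_range_add,
      Finset.prod_congr rfl (g := fun _ => 1), Finset.prod_const_one,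
      Finset.prod_congr rfl (g := fun _ => 2)]
    · simp
    · intro v _; exact if_neg (by omega)
    · intro v hv; exact if_pos (by have := Finset.mem_range.1 hv; omega)
  rw [h, Fintype.card_piFinset]
  have h3 : ∀ v : Fin m, (if v.val ≤ q then ({true} : Finset Bool) else Finset.univ).card
      = if v.val ≤ q then 1 else 2 := by
    intro v; split_ifs <;> simp
  simp_rw [h3, h2]
  push_cast
  rw [pow_sub₀ _ two_ne_zero hq, one_div]

/-- Chernoff's bound, in counting form. -/
lemma card_onesUpTo_gt_le {q : ℕ} (hq : q < m) {δ : ℝ} (h0 : 0 ≤ δ) (h1 : δ ≤ 1) :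
    ((Finset.univ.filter fun x : Fin n → Fin m → Bool =>
      (n : ℝ) * (1 / 2 ^ (q + 1) + δ) < (onesUpTo q x).card).card : ℝ)
      ≤ 2 ^ (n * m) * Real.exp (-(n * (δ ^ 2 / 4))) := by
  classical
  set p : ℝ := 1 / 2 ^ (q + 1) with hp
  have hp0 : 0 < p := by positivity
  have hp1 : p ≤ 1 := by
    rw [hp, div_le_one (by positivity)]
    exact one_le_pow₀ one_le_two
  -- With this tilt the exponent is `δ ^ 2 / 4` with slack `(1 - p) * (δ ^ 2 / 4)`, and `θ ≤ 1`
  -- permits the quadratic bound on `Real.exp θ`.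
  set θ := δ / 2 with hθ
  have hsum : ∑ x : Fin n → Fin m → Bool, Real.exp (θ * (onesUpTo q x).card)
      = (2 ^ m * (1 + p * (Real.exp θ - 1))) ^ n := by
    have h : ∀ x : Fin n → Fin m → Bool, Real.exp (θ * (onesUpTo q x).card)
        = ∏ s, if (∀ v : Fin m, v.val ≤ q → x s v = true) then Real.exp θ else 1 := by
      intro x
      rw [Finset.prod_ite, Finset.prod_const_one, mul_one, Finset.prod_const,
        ← Real.exp_nat_mul, onesUpTo, mul_comm]
    simp_rw [h]
    rw [← Fintype.sum_pow (fun y : Fin m → Bool =>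
      if (∀ v : Fin m, v.val ≤ q → y v = true) then Real.exp θ else 1) n]
    congr 1
    have h' : ∀ y : Fin m → Bool,
        (if (∀ v : Fin m, v.val ≤ q → y v = true) then Real.exp θ else 1)
          = 1 + (Real.exp θ - 1) * if (∀ v : Fin m, v.val ≤ q → y v = true) then 1 else 0 := by
      intro y; split_ifs <;> ring
    rw [Finset.sum_congr rfl fun y _ => h' y, Finset.sum_add_distrib, ← Finset.mul_sum,
      Finset.sum_boole, card_all_true_up_to hq, ← hp]
    simp [Finset.card_univ]
    ring
  have hmarkov : ((Finset.univ.filter fun x : Fin n → Fin m → Bool =>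
      (n : ℝ) * (p + δ) < (onesUpTo q x).card).card : ℝ) * Real.exp (θ * (n * (p + δ)))
      ≤ ∑ x : Fin n → Fin m → Bool, Real.exp (θ * (onesUpTo q x).card) := by
    rw [← nsmul_eq_mul]
    refine (Finset.card_nsmul_le_sum _ _ _ fun x hx => ?_).trans
      (Finset.sum_le_sum_of_subset_of_nonneg (Finset.filter_subset _ _)
        fun _ _ _ => Real.exp_nonneg _)
    exact Real.exp_le_exp.2 (mul_le_mul_of_nonneg_left (Finset.mem_filter.1 hx).2.le (by linarith))
  rw [hsum] at hmarkov
  have hθ1 : Real.exp θ - 1 ≤ θ + θ ^ 2 := by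
    have := Real.abs_exp_sub_one_sub_id_le (x := θ) (by rw [abs_le]; constructor <;> linarith)
    have := (abs_le.1 this).2
    linarith
  have hbase : 1 + p * (Real.exp θ - 1) ≤ Real.exp (p * (θ + θ ^ 2)) := by
    have := Real.add_one_le_exp (p * (θ + θ ^ 2))
    have := mul_le_mul_of_nonneg_left hθ1 hp0.le
    linarith
  have hθ0 : 0 ≤ Real.exp θ - 1 := by
    have := Real.add_one_le_exp θ
    linarith
  have hpow : (2 ^ m * (1 + p * (Real.exp θ - 1))) ^ n
      ≤ 2 ^ (n * m) * Real.exp (n * (p * (θ + θ ^ 2))) := by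
    rw [mul_pow, ← pow_mul, mul_comm m n, Real.exp_nat_mul]
    refine mul_le_mul_of_nonneg_left ?_ (by positivity)
    exact pow_le_pow_left₀ (by positivity) hbase n
  have hfin : (2 : ℝ) ^ (n * m) * Real.exp (n * (p * (θ + θ ^ 2)))
      ≤ 2 ^ (n * m) * Real.exp (-(n * (δ ^ 2 / 4))) * Real.exp (θ * (n * (p + δ))) := by
    rw [mul_assoc, ← Real.exp_add]
    refine mul_le_mul_of_nonneg_left (Real.exp_le_exp.2 ?_) (by positivity)
    have e : -(n * (δ ^ 2 / 4)) + θ * (n * (p + δ)) - n * (p * (θ + θ ^ 2))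
        = n * ((1 - p) * (δ ^ 2 / 4)) := by rw [hθ]; ring
    have : 0 ≤ (n : ℝ) * ((1 - p) * (δ ^ 2 / 4)) :=
      mul_nonneg (by positivity) (mul_nonneg (by linarith) (by positivity))
    linarith
  exact le_of_mul_le_mul_right (hmarkov.trans (hpow.trans hfin)) (Real.exp_pos _)

/-- The subsets of `Fin n` with at most `K` elements. -/
def subsetsOfCardLE (n K : ℕ) : Finset (Finset (Fin n)) :=
  Finset.univ.filter fun A => A.card ≤ K

lemma subsetsOfCardLE_card_pos (n K : ℕ) : 0 < (subsetsOfCardLE n K).card :=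
  Finset.card_pos.2 ⟨∅, by simp [subsetsOfCardLE]⟩

lemma logb_card_subsetsOfCardLE_le {p δ : ℝ} (h0 : 0 < p) (h1 : p ≤ 1 / 2) (hδ : 0 ≤ δ) {K : ℕ}
    (hK : (K : ℝ) ≤ n * (p + δ)) :
    Real.logb 2 (subsetsOfCardLE n K).card ≤ n * (binEntropyBits p + δ * Real.logb 2 p⁻¹) := by
  have hl : 0 < Real.log 2 := Real.log_pos one_lt_two
  -- Weighting `A` by `l ^ A.card` gives total weight `(1 + l) ^ n = (1 - p)⁻¹ ^ n`, while `l ≤ 1`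
  -- makes each counted subset weigh at least `l ^ K`.
  set l : ℝ := p / (1 - p) with hlam
  have hq : 0 < 1 - p := by linarith
  have hl0 : 0 < l := by positivity
  have hl1 : l ≤ 1 := by rw [hlam, div_le_one hq]; linarith
  have hcard : ((subsetsOfCardLE n K).card : ℝ) * l ^ K ≤ (1 - p)⁻¹ ^ n := by
    have h := Finset.sum_pow_mul_eq_add_pow l 1 (Finset.univ : Finset (Fin n))
    simp only [one_pow, mul_one, Finset.powerset_univ, Finset.card_univ, Fintype.card_fin] at h
    have e : l + 1 = (1 - p)⁻¹ := by rw [hlam]; field_simp; ring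
    rw [e] at h
    rw [← h, ← nsmul_eq_mul]
    refine (Finset.card_nsmul_le_sum _ _ _ fun A hA => ?_).trans
      (Finset.sum_le_sum_of_subset_of_nonneg (Finset.filter_subset _ _)
        fun _ _ _ => by positivity)
    exact pow_le_pow_of_le_one hl0.le hl1 (Finset.mem_filter.1 hA).2
  have hc : (0 : ℝ) < (subsetsOfCardLE n K).card := by exact_mod_cast subsetsOfCardLE_card_pos n K
  have hlog := Real.log_le_log (by positivity) hcard
  rw [Real.log_mul hc.ne' (by positivity), Real.log_pow, Real.log_pow, Real.log_inv, hlam,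
    Real.log_div h0.ne' hq.ne'] at hlog
  have hneg : Real.log p - Real.log (1 - p) ≤ 0 := by
    have := Real.log_le_log h0 (show p ≤ 1 - p by linarith)
    linarith
  have h3 := mul_le_mul_of_nonpos_right hK hneg
  have h4 : 0 ≤ (n : ℝ) * (δ * -Real.log (1 - p)) := by
    have := Real.log_nonpos hq.le (by linarith)
    exact mul_nonneg (by positivity) (mul_nonneg hδ (by linarith))
  have key : Real.log (subsetsOfCardLE n K).card ≤ n * (Real.binEntropy p + δ * Real.log p⁻¹) := by
    rw [Real.binEntropy, Real.log_inv, Real.log_inv]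
    nlinarith
  rw [Real.logb, binEntropyBits, Real.logb, div_le_iff₀ hl]
  refine key.trans (le_of_eq ?_)
  field_simp

end Counting

/-! ### Summing the rates of the interactive scheme -/

section Numerics

lemma logb_two_exp_lt : Real.logb 2 (Real.exp 1) < 2 := by
  rw [Real.logb_lt_iff_lt_rpow one_lt_two (Real.exp_pos 1)]
  have := Real.exp_one_lt_d9
  norm_num
  linarith

lemma binEntropyBits_two_pow_le (i : ℕ) :
    binEntropyBits (1 / 2 ^ i) ≤ i / 2 ^ i + Real.logb 2 (Real.exp 1) / 2 ^ i := by
  have hl : 0 < Real.log 2 := Real.log_pos one_lt_two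
  set p : ℝ := 1 / 2 ^ i with hp
  have hp0 : 0 < p := by positivity
  have hp1 : p ≤ 1 := by
    rw [hp, div_le_one (by positivity)]
    exact one_le_pow₀ one_le_two
  have hlogp : Real.log p⁻¹ = i * Real.log 2 := by
    rw [hp, one_div, inv_inv, Real.log_pow]
  -- This is `log x ≤ x - 1` at `x = (1 - p)⁻¹`; the case `p = 1` arises from `i = 0`.
  have h2 : (1 - p) * Real.log (1 - p)⁻¹ ≤ p := by
    rcases hp1.eq_or_lt with h | h
    · rw [h]; norm_num
    · have hq : 0 < 1 - p := by linarith
      have h3 := Real.log_le_sub_one_of_pos (inv_pos.2 hq)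
      have h4 := mul_le_mul_of_nonneg_left h3 hq.le
      rw [mul_sub, mul_inv_cancel₀ hq.ne'] at h4
      linarith
  rw [binEntropyBits, Real.logb, Real.log_exp, div_le_iff₀ hl, Real.binEntropy, hlogp]
  have e : ((i : ℝ) / 2 ^ i + 1 / Real.log 2 / 2 ^ i) * Real.log 2
      = p * (i * Real.log 2) + p := by
    rw [hp]; field_simp
  rw [e]
  linarith

lemma sum_visit_rates_lt (k : ℕ) :
    ∑ i ∈ Finset.Icc 1 k, (binEntropyBits (1 / 2 ^ i) + 1 / 2 ^ i)
      < 3 + Real.logb 2 (Real.exp 1) := by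
  set L := Real.logb 2 (Real.exp 1) with hL
  have hL0 : 0 < L := Real.logb_pos one_lt_two (by simp)
  have h1 : ∑ i ∈ Finset.Icc 1 k, (binEntropyBits (1 / 2 ^ i) + 1 / 2 ^ i)
      ≤ ∑ i ∈ Finset.Icc 1 k, ((i : ℝ) / 2 ^ i + L / 2 ^ i + 1 / 2 ^ i) :=
    Finset.sum_le_sum fun i _ => by
      have := binEntropyBits_two_pow_le i
      linarith
  have h2 : ∑ i ∈ Finset.Icc 1 k, ((i : ℝ) / 2 ^ i + L / 2 ^ i + 1 / 2 ^ i)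
      = 3 + L - (k + 3 + L) / 2 ^ k := by
    induction k with
    | zero => simp
    | succ k ih =>
      rw [Finset.sum_Icc_succ_top (by omega), ih (Finset.sum_le_sum fun i _ => by
        have := binEntropyBits_two_pow_le i
        linarith), pow_succ]
      push_cast
      field_simp
      ring
  have h3 : 0 < ((k : ℝ) + 3 + L) / 2 ^ k := by positivity
  linarith

end Numerics

/-! ### The interactive scheme -/

section VisitScheme

variable {m n : ℕ}

/-- The set of ones of the running minimum after the leaves `1, …, q` have replied, as computed by
the centre from its own block `x` and the received messages `h`. -/
noncomputable def runningOnes (h : ℕ → ℕ → ℕ) (x : Fin n → Bool) : ℕ → Finset (Fin n)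
  | 0 => Finset.univ.filter fun s => x s = true
  | q + 1 => elemAt (runningOnes h x q).powerset (h (2 * q + 1) (q + 1))

/-- Alphabet sizes of the interactive scheme, where `K q` bounds the number of ones of the
running minimum which is sent to the leaf `q + 1`. -/
def visitSize (n : ℕ) (K : ℕ → ℕ) (r j k : ℕ) : ℕ :=
  if r % 2 = 0 then
    if j = 0 ∧ k = r / 2 + 1 then (subsetsOfCardLE n (K (r / 2))).card else 1
  else if j = r / 2 + 1 ∧ k = 0 then 2 ^ K (r / 2) else 1

lemma visitSize_pos (n : ℕ) (K : ℕ → ℕ) (r j k : ℕ) : 0 < visitSize n K r j k := by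
  unfold visitSize
  split_ifs
  · exact subsetsOfCardLE_card_pos _ _
  all_goals positivity

/-- The encoders of the interactive scheme: the centre describes the set of ones of the
running minimum, and the leaf replies with the subset of its own ones. -/
noncomputable def visitEnc (n : ℕ) (K : ℕ → ℕ) (r j : ℕ) (x : Fin n → Bool) (h : ℕ → ℕ → ℕ) : ℕ :=
  if j = 0 then indexIn (subsetsOfCardLE n (K (r / 2))) (runningOnes h x (r / 2))
  else indexIn (elemAt (subsetsOfCardLE n (K (r / 2))) (h (r - 1) 0)).powerset
    ((elemAt (subsetsOfCardLE n (K (r / 2))) (h (r - 1) 0)).filter fun s => x s = true)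

/-- The code of the interactive scheme. -/
noncomputable def visitCode (m n : ℕ) (K : ℕ → ℕ) : NetworkCode (Fin m) Bool Bool (2 * m - 2) n :=
  natCode m (2 * m - 2) n (visitSize n K) (visitSize_pos n K) (visitEnc n K)
    (fun j x h s => if j = 0 then decide (s ∈ runningOnes h x (m - 1)) else false)

lemma filter_onesUpTo (x : Fin n → Fin m → Bool) {q : ℕ} (hq : q + 1 < m) :
    ((onesUpTo q x).filter fun s => x s ⟨q + 1, hq⟩ = true) = onesUpTo (q + 1) x := by
  ext s
  simp only [onesUpTo, Finset.mem_filter, Finset.mem_univ, true_and]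
  constructor
  · rintro ⟨h1, h2⟩ v hv
    rcases Nat.lt_or_ge q v.val with h | h
    · have : v = ⟨q + 1, hq⟩ := Fin.ext (by simp; omega)
      rw [this]; exact h2
    · exact h1 v h
  · exact fun h => ⟨fun v hv => h v (by omega), h _ le_rfl⟩

lemma runningOnes_eq (x : Fin n → Fin m → Bool) {z : Fin m} (hz : z.val = 0) (h : ℕ → ℕ → ℕ)
    {q : ℕ} (hq : q < m)
    (hh : ∀ p < q, h (2 * p + 1) (p + 1) = indexIn (onesUpTo p x).powerset (onesUpTo (p + 1) x)) :
    runningOnes h (fun s => x s z) q = onesUpTo q x := by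
  induction q with
  | zero =>
    ext s
    simp only [runningOnes, onesUpTo, Finset.mem_filter, Finset.mem_univ, true_and]
    refine ⟨fun h v hv => ?_, fun h => h z hz.le⟩
    have : v = z := Fin.ext (by omega)
    rw [this]; exact h
  | succ q ih =>
    rw [runningOnes, ih (by omega) fun p hp => hh p (by omega), hh q (by omega), elemAt_indexIn]
    rw [Finset.mem_powerset, ← filter_onesUpTo x hq]
    exact Finset.filter_subset _ _

/-- As long as no running set overflows its budget `K q`, no index is altered by the reduction
modulo the alphabet size. Strong induction is needed because the description sent in round `2 * q`
uses all earlier replies. -/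
lemma visitCode_natMsg {K : ℕ → ℕ} {x : Fin n → Fin m → Bool} {z : Fin m} (hz : z.val = 0)
    (hx : ∀ q, q + 1 < m → (onesUpTo q x).card ≤ K q) {q : ℕ} (hq : q + 1 < m) :
    (visitCode m n K).natMsg x (2 * q + 1) (q + 1) 0
      = indexIn (onesUpTo q x).powerset (onesUpTo (q + 1) x) := by
  induction q using Nat.strong_induction_on with
  | _ q ih =>
    have hmem : onesUpTo q x ∈ subsetsOfCardLE n (K q) := by
      simpa [subsetsOfCardLE] using hx q hq
    have hdown : (visitCode m n K).natMsg x (2 * q) 0 (q + 1)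
        = indexIn (subsetsOfCardLE n (K q)) (onesUpTo q x) := by
      have := natCode_natMsg (t := 2 * m - 2) (size := visitSize n K) (hs := visitSize_pos n K)
        (enc := visitEnc n K)
        (dec := fun j x h s => if j = 0 then decide (s ∈ runningOnes h x (m - 1)) else false)
        x (r := 2 * q) z (by omega) hq
      rw [hz] at this
      rw [visitCode, this, ← visitCode]
      have e1 : 2 * q / 2 = q := by omega
      have e2 : 2 * q % 2 = 0 := by omega
      rw [visitEnc, if_pos rfl, e1, runningOnes_eq x hz _ (by omega), Nat.mod_eq_of_lt]
      · refine (indexIn_lt hmem).trans_eq ?_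
        rw [visitSize, if_pos e2, e1, if_pos ⟨rfl, rfl⟩]
      · intro p hp
        rw [if_pos (by omega)]
        exact ih p hp (by omega)
    have := natCode_natMsg (t := 2 * m - 2) (size := visitSize n K) (hs := visitSize_pos n K)
      (enc := visitEnc n K)
      (dec := fun j x h s => if j = 0 then decide (s ∈ runningOnes h x (m - 1)) else false)
      x (r := 2 * q + 1) (⟨q + 1, hq⟩ : Fin m) (k := 0) (by omega) (by omega)
    simp only at this
    rw [visitCode, this, ← visitCode]
    have e1 : (2 * q + 1) / 2 = q := by omega
    have e2 : ¬ (2 * q + 1) % 2 = 0 := by omega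
    have e3 : 2 * q + 1 - 1 = 2 * q := by omega
    rw [visitEnc, if_neg q.succ_ne_zero, e1, e3, if_pos (by omega), hdown, elemAt_indexIn hmem,
      filter_onesUpTo, Nat.mod_eq_of_lt]
    have hsub : onesUpTo (q + 1) x ∈ (onesUpTo q x).powerset := by
      rw [Finset.mem_powerset, ← filter_onesUpTo x hq]
      exact Finset.filter_subset _ _
    refine (indexIn_lt hsub).trans_le ?_
    rw [visitSize, if_neg e2, e1, if_pos ⟨rfl, rfl⟩, Finset.card_powerset]
    exact Nat.pow_le_pow_right two_pos (hx q hq)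

lemma visitCode_estimate {K : ℕ → ℕ} {x : Fin n → Fin m → Bool}
    (hx : ∀ q, q + 1 < m → (onesUpTo q x).card ≤ K q) (j : Fin m) :
    (visitCode m n K).estimate x j = fun s => (starMin m).target j (x s) := by
  rw [visitCode, natCode_estimate, ← visitCode]
  funext s
  by_cases hj : j.val = 0
  · have hm : 0 < m := j.pos
    simp only [hj, if_true, starMin]
    rw [runningOnes_eq x hj _ (by omega)
      fun p hp => visitCode_natMsg hj hx (by omega), Bool.eq_iff_iff, decide_eq_true_iff]
    simp only [onesUpTo, Finset.mem_filter, Finset.mem_univ, true_and]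
    constructor
    · intro h
      exact top_le_iff.1 (Finset.le_inf fun v _ => (h v (by omega)).ge)
    · intro h v _
      have := Finset.inf_le (f := x s) (Finset.mem_univ v)
      rw [h] at this
      exact top_le_iff.1 this
  · simp [hj, starMin]

/-- An error forces some running set to exceed its budget; union bound over the sets, then Chernoff.
-/
lemma visitCode_blockError_le {K : ℕ → ℕ} {δ : ℝ} (h0 : 0 ≤ δ) (h1 : δ ≤ 1)
    (hK : ∀ q, K q = ⌊(n : ℝ) * (1 / 2 ^ (q + 1) + δ)⌋₊) (j : Fin m) :
    (starMin m).blockError (visitCode m n K) j ≤ m * Real.exp (-(n * (δ ^ 2 / 4))) := by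
  classical
  rw [starMin_blockError_eq, div_le_iff₀ (by positivity)]
  have hsub : (Finset.univ.filter fun x : Fin n → Fin m → Bool =>
      (visitCode m n K).estimate x j ≠ fun s => (starMin m).target j (x s))
      ⊆ (Finset.univ : Finset (Fin m)).biUnion fun q => Finset.univ.filter
        fun x : Fin n → Fin m → Bool =>
          (n : ℝ) * (1 / 2 ^ (q.val + 1) + δ) < (onesUpTo q.val x).card := by
    intro x hx
    by_contra hcon
    refine (Finset.mem_filter.1 hx).2 (visitCode_estimate (fun q hq => ?_) j)
    rw [hK]
    refine Nat.le_floor (not_lt.1 fun h => hcon ?_)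
    exact Finset.mem_biUnion.2 ⟨⟨q, by omega⟩, Finset.mem_univ _, by simpa using h⟩
  calc _ ≤ ∑ q : Fin m, ((Finset.univ.filter fun x : Fin n → Fin m → Bool =>
          (n : ℝ) * (1 / 2 ^ (q.val + 1) + δ) < (onesUpTo q.val x).card).card : ℝ) := by
        exact_mod_cast (Finset.card_le_card hsub).trans Finset.card_biUnion_le
    _ ≤ ∑ q : Fin m, 2 ^ (n * m) * Real.exp (-(n * (δ ^ 2 / 4))) :=
        Finset.sum_le_sum fun q _ => card_onesUpTo_gt_le q.isLt h0 h1
    _ = _ := by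
        simp only [Finset.sum_const, Finset.card_univ, Fintype.card_fin, nsmul_eq_mul]
        ring

lemma visitCode_follows (K : ℕ → ℕ) :
    (starMin m).Follows (visitLeaves m) (visitCode m n K) := by
  intro r j k h
  change visitSize n K r j k = 1
  unfold visitSize
  split_ifs with h1 h2 h2
  · exact absurd ⟨mem_starMin_links.2 (Or.inr ⟨h2.1, by simp [h2.2]⟩), by
      simpa [visitLeaves, h1] using h2⟩ h
  · rfl
  · exact absurd ⟨mem_starMin_links.2 (Or.inl ⟨by simp [h2.1], h2.2⟩), by
      simpa [visitLeaves, h1] using h2⟩ h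
  · rfl

lemma visitCode_rate_le {K : ℕ → ℕ} {δ ε : ℝ} (hn : 0 < n) (h0 : 0 ≤ δ) (hδ : δ * m ≤ ε)
    (hK : ∀ q, K q = ⌊(n : ℝ) * (1 / 2 ^ (q + 1) + δ)⌋₊) (r : Fin (2 * m - 2))
    (e : Fin m × Fin m) :
    1 / (n : ℝ) * Real.logb 2 ((visitCode m n K).size r e.1 e.2) ≤ visitRates m r e + ε := by
  have hn' : (0 : ℝ) < n := by exact_mod_cast hn
  have hm : (1 : ℝ) ≤ m := by exact_mod_cast e.1.pos
  have hr : r.val / 2 + 1 < m := by have := r.isLt; omega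
  have hε : 0 ≤ ε := (mul_nonneg h0 (by linarith)).trans hδ
  have hK' : (K (r.val / 2) : ℝ) ≤ n * (1 / 2 ^ (r.val / 2 + 1) + δ) := by
    rw [hK]
    exact Nat.floor_le (by positivity)
  change 1 / (n : ℝ) * Real.logb 2 (visitSize n K r e.1 e.2 : ℕ) ≤ _
  rw [one_div, inv_mul_le_iff₀ hn', visitRates]
  by_cases he : e ∈ visitLeaves m r
  · rw [Set.indicator_of_mem he]
    by_cases h : r.val % 2 = 0
    · rw [if_pos h, visitSize, if_pos h, if_pos (by simpa [visitLeaves, h] using he)]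
      refine (logb_card_subsetsOfCardLE_le (by positivity) ?_ h0 hK').trans ?_
      · rw [pow_succ]
        refine one_div_le_one_div_of_le two_pos ?_
        have : (1 : ℝ) ≤ 2 ^ (r.val / 2) := one_le_pow₀ one_le_two
        linarith
      · refine mul_le_mul_of_nonneg_left (add_le_add_right ?_ _) hn'.le
        rw [one_div, inv_inv, Real.logb_pow, Real.logb_self_eq_one one_lt_two, mul_one]
        refine (mul_le_mul_of_nonneg_left ?_ h0).trans hδ
        exact_mod_cast hr.le
    · rw [if_neg h, visitSize, if_neg h, if_pos (by simpa [visitLeaves, h] using he)]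
      push_cast
      rw [Real.logb_pow, Real.logb_self_eq_one one_lt_two, mul_one]
      refine hK'.trans (mul_le_mul_of_nonneg_left (add_le_add_right ?_ _) hn'.le)
      nlinarith
  · rw [Set.indicator_of_notMem he]
    have : visitSize n K r e.1 e.2 = 1 :=
      visitCode_follows K r e.1 e.2 fun h => he h.2
    rw [this]
    simp only [Nat.cast_one, Real.logb_one]
    positivity

lemma admissible_visit (hm : 1 ≤ m) : (starMin m).Admissible (visitLeaves m) (visitRates m) := by
  intro ε hε
  have hm' : (1 : ℝ) ≤ m := by exact_mod_cast hm
  -- Describing a set of density `2 ^ (-i)` has overhead `δ * i ≤ δ * m`, hence the division by `m`;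
  -- the cap at 1 is for Chernoff.
  set δ : ℝ := min ε 1 / m with hδ
  have hδ0 : 0 < δ := by positivity
  have hδ1 : δ ≤ 1 := by
    rw [hδ, div_le_one (by linarith)]
    exact (min_le_right _ _).trans hm'
  have hδε : δ * m ≤ ε := by
    rw [hδ, div_mul_cancel₀ _ (by linarith)]
    exact min_le_left _ _
  have ht : Tendsto (fun n : ℕ => (m : ℝ) * Real.exp (-(n * (δ ^ 2 / 4)))) atTop
      (nhds (m * 0)) := by
    refine Tendsto.const_mul _ (Real.tendsto_exp_neg_atTop_nhds_zero.comp ?_)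
    exact tendsto_natCast_atTop_atTop.atTop_mul_const (by positivity)
  rw [mul_zero] at ht
  obtain ⟨N, hN⟩ := eventually_atTop.1 (ht.eventually_le_const hε)
  refine ⟨N, fun n hn => ⟨visitCode m n fun q => ⌊(n : ℝ) * (1 / 2 ^ (q + 1) + δ)⌋₊,
    visitCode_follows _, fun r e _ => ?_, fun j => ?_⟩⟩
  · exact visitCode_rate_le (by omega) hδ0.le hδε (fun _ => rfl) r e
  · exact (visitCode_blockError_le hδ0.le hδ1 (fun _ => rfl) j).trans (hN n hn.le)

lemma sum_links_visitRates (r : Fin (2 * m - 2)) :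
    ∑ e ∈ (starMin m).links, visitRates m r e =
      if r.val % 2 = 0 then binEntropyBits (1 / 2 ^ (r.val / 2 + 1))
      else 1 / 2 ^ (r.val / 2 + 1) := by
  classical
  have hr : r.val / 2 + 1 < m := by have := r.isLt; omega
  have hlinks : (starMin m).links.filter (fun e => e ∈ visitLeaves m r)
      = {if r.val % 2 = 0 then ((⟨0, by omega⟩ : Fin m), (⟨r.val / 2 + 1, hr⟩ : Fin m))
        else (⟨r.val / 2 + 1, hr⟩, ⟨0, by omega⟩)} := by
    ext ⟨a, b⟩
    rw [Finset.mem_filter, mem_starMin_links, Finset.mem_singleton]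
    split_ifs with h <;>
    · simp only [visitLeaves, h, if_true, if_false, Set.mem_ofPred_eq, Prod.mk.injEq, Fin.ext_iff]
      omega
  simp only [visitRates, Set.indicator_apply]
  rw [← Finset.sum_filter, hlinks, Finset.sum_singleton]

lemma sum_range_two_mul (f : ℕ → ℝ) (k : ℕ) :
    ∑ r ∈ Finset.range (2 * k), f r = ∑ q ∈ Finset.range k, (f (2 * q) + f (2 * q + 1)) := by
  induction k with
  | zero => simp
  | succ k ih =>
    rw [Finset.sum_range_succ, ← ih, mul_add, mul_one, Finset.sum_range_succ,
      Finset.sum_range_succ, add_assoc]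

lemma sumTotalRate_visit (m : ℕ) : (starMin m).sumTotalRate (visitRates m) =
    ∑ i ∈ Finset.Icc 1 (m - 1), (binEntropyBits (1 / 2 ^ i) + 1 / 2 ^ i) := by
  rw [NetworkProblem.sumTotalRate]
  simp_rw [sum_links_visitRates]
  rw [Fin.sum_univ_eq_sum_range (fun r => if r % 2 = 0 then binEntropyBits (1 / 2 ^ (r / 2 + 1))
      else 1 / 2 ^ (r / 2 + 1)) (2 * m - 2), show 2 * m - 2 = 2 * (m - 1) by omega,
    sum_range_two_mul, Finset.range_eq_Ico]
  have hIcc : Finset.Icc 1 (m - 1) = Finset.Ico (0 + 1) (m - 1 + 1) := by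
    ext i
    simp only [Finset.mem_Icc, Finset.mem_Ico]
    omega
  rw [hIcc, ← Finset.sum_Ico_add' (fun i => binEntropyBits (1 / 2 ^ i) + 1 / 2 ^ i)]
  refine Finset.sum_congr rfl fun q _ => ?_
  have e1 : 2 * q / 2 = q := by omega
  have e2 : (2 * q + 1) / 2 = q := by omega
  have e3 : 2 * q % 2 = 0 := by omega
  have e4 : ¬ (2 * q + 1) % 2 = 0 := by omega
  rw [if_pos e3, if_neg e4, e1, e2]

end VisitScheme

/-! ### Minimum sum rates and the main theorem -/

lemma minSumRate_le_of_admissible {m t : ℕ} {P : Fin t → Set (Fin m × Fin m)}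
    {R : Fin t → Fin m × Fin m → ℝ} (hR : (starMin m).Admissible P R) :
    (starMin m).minSumRate t ≤ (starMin m).sumTotalRate R := by
  refine csInf_le ⟨0, ?_⟩ ⟨R, admissible_mono (fun i e he _ => he) hR, rfl⟩
  rintro _ ⟨R', hR', rfl⟩
  exact sumTotalRate_nonneg hR'

lemma minSumRate_nonneg (m t : ℕ) : 0 ≤ (starMin m).minSumRate t := by
  refine Real.sInf_nonneg ?_
  rintro _ ⟨R', hR', rfl⟩
  exact sumTotalRate_nonneg hR'

lemma minSumRate_one {m : ℕ} (hm : 1 ≤ m) : (starMin m).minSumRate 1 = (m : ℝ) - 1 :=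
  (isLeast_achievableSums_one_round hm).csInf_eq

lemma minSumRate_visit_lt {m : ℕ} (hm : 1 ≤ m) :
    (starMin m).minSumRate (2 * m - 2) < 3 + Real.logb 2 (Real.exp 1) := by
  refine (minSumRate_le_of_admissible (admissible_visit hm)).trans_lt ?_
  rw [sumTotalRate_visit]
  exact sum_visit_rates_lt _

theorem mainTheorem12 :
    (∀ m : ℕ, 3 ≤ m →
      -- one round is the minimum number of rounds, and it costs exactly `m - 1`
      IsLeast {t : ℕ | (starMin m).Feasible t} 1 ∧
      IsLeast ((starMin m).achievableSums ((starMin m).fullProtocol 1)) ((m : ℝ) - 1) ∧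
      (starMin m).minSumRate 1 = (m : ℝ) - 1 ∧
      -- so does every non-interactive scheme, with any number of rounds
      (∀ t : ℕ, 1 ≤ t →
        IsLeast ((starMin m).achievableSums (leavesToCentre m t)) ((m : ℝ) - 1)) ∧
      -- the interactive scheme with `2m - 2` rounds
      (starMin m).Admissible (visitLeaves m) (visitRates m) ∧
      (starMin m).sumTotalRate (visitRates m) =
        ∑ i ∈ Finset.Icc 1 (m - 1), (binEntropyBits (1 / 2 ^ i) + 1 / 2 ^ i) ∧
      (starMin m).sumTotalRate (visitRates m) < 3 + Real.logb 2 (Real.exp 1) ∧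
      (starMin m).minSumRate (2 * m - 2) < 3 + Real.logb 2 (Real.exp 1)) ∧
    -- interaction is useful
    (∀ m : ℕ, 6 ≤ m → (starMin m).minSumRate (2 * m - 2) < (starMin m).minSumRate 1) ∧
    -- scaling in the number of nodes
    (fun m : ℕ => (starMin m).minSumRate 1) =Θ[atTop] (fun m : ℕ => (m : ℝ)) ∧
    (fun m : ℕ => (starMin m).minSumRate (2 * m - 2)) =O[atTop] (fun _ : ℕ => (1 : ℝ)) := by

  refine ⟨fun m hm => ⟨isLeast_feasible (by omega), isLeast_achievableSums_one_round (by omega),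
    minSumRate_one (by omega), fun t ht => isLeast_achievableSums_leavesToCentre (by omega) ht,
    admissible_visit (by omega), sumTotalRate_visit m, ?_, minSumRate_visit_lt (by omega)⟩,
    fun m hm => ?_, ?_, ?_⟩
  · rw [sumTotalRate_visit]
    exact sum_visit_rates_lt _
  · rw [minSumRate_one (by omega)]
    have h6 : (6 : ℝ) ≤ m := by exact_mod_cast hm
    have := minSumRate_visit_lt (m := m) (by omega)
    -- Since `e < 4`, the interactive cost is below 5, and `m - 1 ≥ 5`.
    have := logb_two_exp_lt
    linarith
  · have h : ∀ᶠ m : ℕ in atTop, (2 : ℝ) ≤ m ∧ (starMin m).minSumRate 1 = (m : ℝ) - 1 :=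
      (eventually_ge_atTop 2).mono fun m hm =>
        ⟨by exact_mod_cast hm, minSumRate_one (by omega)⟩
    refine ⟨IsBigO.of_bound 1 (h.mono fun m hm => ?_), IsBigO.of_bound 2 (h.mono fun m hm => ?_)⟩
    all_goals
      obtain ⟨h2, he⟩ := hm
      rw [he, Real.norm_of_nonneg (by linarith), Real.norm_of_nonneg (by linarith)]
      linarith
  · refine IsBigO.of_bound (3 + Real.logb 2 (Real.exp 1))
      ((eventually_ge_atTop 1).mono fun m hm => ?_)
    rw [Real.norm_of_nonneg (minSumRate_nonneg _ _), norm_one, mul_one]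
    exact (minSumRate_visit_lt hm).le
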